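/- Let $(X,\mu)$ be a finite measure space and let $\varphi \in \mathrm{L}^\infty(X \times X)$. For $f \in \mathrm{L}^2(X\times X)$ let $K_f$ be the Hilbert--Schmidt operator on $\mathrm{L}^2(X)$ given by $(K_f\xi)(x)=\int_X f(x,y)\xi(y)\,\mathrm{d}\mu(y)$. We say that $\varphi$ induces a measurable Schur multiplier if the map $K_f \mapsto K_{\varphi f}$ on Hilbert--Schmidt operators is bounded for the operator norm; its unique weak* continuous linear extension $M_\varphi \colon \mathrm{B}(\mathrm{L}^2(X)) \to \mathrm{B}(\mathrm{L}^2(X))$ is then called the measurable Schur multiplier with symbol $\varphi$. A measurable function $\varphi \colon X\times X \to \mathbb{C}$ is called an integrally positive definite kernel if for every $\xi \in \mathrm{L}^1(X)$ the function $(x,y)\mapsto \varphi(x,y)\overline{\xi(x)}\xi(y)$ is integrable on $X\times X$ and $$\iint_{X\times X} \varphi(x,y)\overline{\xi(x)}\xi(y)\,\mathrm{d}\mu(x)\,\mathrm{d}\mu(y) \geq 0.$$ Consider the following properties: 1. $\varphi$ induces a completely positive measurable Schur multiplier $M_\varphi$; 2. $\varphi$ induces a positive measurable Schur multiplier $M_\varphi$;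 3. $\varphi$ (that is, each of its measurable representatives) is an integrally positive definite kernel. Then $1 \Leftrightarrow 2 \Rightarrow 3$. -/

import Mathlib

open MeasureTheory
open scoped ENNReal InnerProductSpace ComplexOrder

noncomputable section

namespace SchurMult

section HilbertSchmidt

variable {X : Type*} [MeasurableSpace X] {μ : Measure X} [SFinite μ]

theorem eLpNorm_two_sq {Y E : Type*} [MeasurableSpace Y] [NormedAddCommGroup E] {ν : Measure Y}
    (f : Y → E) : eLpNorm f 2 ν ^ (2 : ℝ) = ∫⁻ y, ‖f y‖ₑ ^ (2 : ℝ) ∂ν := by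
  have h := eLpNorm_nnreal_pow_eq_lintegral (μ := ν) (f := f) (p := 2) two_ne_zero
  simpa using h

theorem lintegral_section_sq (f : Lp ℂ 2 (μ.prod μ)) :
    ∫⁻ x, eLpNorm (fun y => f (x, y)) 2 μ ^ (2 : ℝ) ∂μ = eLpNorm f 2 (μ.prod μ) ^ (2 : ℝ) := by
  rw [eLpNorm_two_sq, lintegral_prod _
    ((Lp.aestronglyMeasurable f).enorm.pow_const _)]
  simp_rw [eLpNorm_two_sq]

theorem memLp_section (f : Lp ℂ 2 (μ.prod μ)) :
    ∀ᵐ x ∂μ, MemLp (fun y => f (x, y)) 2 μ := by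
  have hlt : ∫⁻ x, eLpNorm (fun y => f (x, y)) 2 μ ^ (2 : ℝ) ∂μ ≠ ∞ := by
    rw [lintegral_section_sq]
    exact (ENNReal.rpow_lt_top_of_nonneg (by norm_num) (Lp.eLpNorm_ne_top f)).ne
  have hm : AEMeasurable (fun x => eLpNorm (fun y => f (x, y)) 2 μ ^ (2 : ℝ)) μ := by
    simp_rw [eLpNorm_two_sq]
    exact ((Lp.aestronglyMeasurable f).enorm.pow_const _).lintegral_prod_right'
  filter_upwards [ae_lt_top' hm hlt, (Lp.aestronglyMeasurable f).prodMk_left] with x hx hxm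
  exact ⟨hxm, (ENNReal.rpow_lt_top_iff_of_pos (by norm_num)).1 hx⟩

/-- The function `x ↦ ∫ f(x,y) ξ(y) dy`. -/
def kernelFun (f : Lp ℂ 2 (μ.prod μ)) (ξ : Lp ℂ 2 μ) (x : X) : ℂ :=
  ∫ y, f (x, y) * ξ y ∂μ

theorem integrable_section_mul (f : Lp ℂ 2 (μ.prod μ)) :
    ∀ᵐ x ∂μ, ∀ ξ : Lp ℂ 2 μ, Integrable (fun y => f (x, y) * ξ y) μ := by
  filter_upwards [memLp_section f] with x hx ξ
  exact hx.integrable_mul (Lp.memLp ξ)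

theorem enorm_kernelFun_le (f : Lp ℂ 2 (μ.prod μ)) (ξ : Lp ℂ 2 μ) :
    ∀ᵐ x ∂μ, ‖kernelFun f ξ x‖ₑ ≤ eLpNorm (fun y => f (x, y)) 2 μ * eLpNorm ξ 2 μ := by
  filter_upwards [memLp_section f] with x hx
  refine (enorm_integral_le_lintegral_enorm _).trans ?_
  rw [← eLpNorm_one_eq_lintegral_enorm]
  have h := eLpNorm_smul_le_mul_eLpNorm (p := 2) (q := 2) (r := 1) (μ := μ)
    (Lp.aestronglyMeasurable ξ) hx.1
  simpa only [smul_eq_mul, Pi.mul_def] using h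

theorem eLpNorm_kernelFun_le (f : Lp ℂ 2 (μ.prod μ)) (ξ : Lp ℂ 2 μ) :
    eLpNorm (kernelFun f ξ) 2 μ ≤ eLpNorm f 2 (μ.prod μ) * eLpNorm ξ 2 μ := by
  rw [← ENNReal.rpow_le_rpow_iff (z := 2) (by norm_num), eLpNorm_two_sq,
    ENNReal.mul_rpow_of_nonneg _ _ (by norm_num), ← lintegral_section_sq,
    ← lintegral_mul_const' _ _
      (ENNReal.rpow_lt_top_of_nonneg (by norm_num) (Lp.eLpNorm_ne_top ξ)).ne]
  refine lintegral_mono_ae ?_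
  filter_upwards [enorm_kernelFun_le f ξ] with x hx
  rw [← ENNReal.mul_rpow_of_nonneg _ _ (by norm_num)]
  exact ENNReal.rpow_le_rpow hx (by norm_num)

theorem memLp_kernelFun (f : Lp ℂ 2 (μ.prod μ)) (ξ : Lp ℂ 2 μ) :
    MemLp (kernelFun f ξ) 2 μ := by
  refine ⟨?_, (eLpNorm_kernelFun_le f ξ).trans_lt
    (ENNReal.mul_lt_top (Lp.eLpNorm_lt_top f) (Lp.eLpNorm_lt_top ξ))⟩
  exact ((Lp.aestronglyMeasurable f).mul
    (Lp.aestronglyMeasurable ξ).comp_snd).integral_prod_right'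

/-- The Hilbert–Schmidt operator `K_f` on `L²(X)` with kernel `f ∈ L²(X × X)`:
`(K_f ξ)(x) = ∫ f(x,y) ξ(y) dy`. -/
def kernelOp (f : Lp ℂ 2 (μ.prod μ)) : Lp ℂ 2 μ →L[ℂ] Lp ℂ 2 μ :=
  LinearMap.mkContinuous
    { toFun := fun ξ => (memLp_kernelFun f ξ).toLp (kernelFun f ξ)
      map_add' := by
        intro ξ η
        rw [← MemLp.toLp_add]
        refine MemLp.toLp_congr _ _ ?_
        filter_upwards [integrable_section_mul f] with x hx
        simp only [kernelFun, Pi.add_apply]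
        rw [← integral_add (hx ξ) (hx η)]
        refine integral_congr_ae ?_
        filter_upwards [Lp.coeFn_add ξ η] with y hy
        rw [hy, Pi.add_apply, mul_add]
      map_smul' := by
        intro c ξ
        rw [RingHom.id_apply, ← MemLp.toLp_const_smul]
        refine MemLp.toLp_congr _ _ (Filter.Eventually.of_forall fun x => ?_)
        simp only [kernelFun, Pi.smul_apply, smul_eq_mul]
        rw [← integral_const_mul]
        refine integral_congr_ae ?_
        filter_upwards [Lp.coeFn_smul c ξ] with y hy
        rw [hy, Pi.smul_apply, smul_eq_mul]
        ring }
    ‖f‖ (by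
      intro ξ
      simp only [LinearMap.coe_mk, AddHom.coe_mk]
      rw [Lp.norm_toLp, Lp.norm_def, Lp.norm_def, ← ENNReal.toReal_mul]
      exact ENNReal.toReal_mono
        (ENNReal.mul_lt_top (Lp.eLpNorm_lt_top f) (Lp.eLpNorm_lt_top ξ)).ne
        (eLpNorm_kernelFun_le f ξ))

theorem kernelOp_apply_ae (f : Lp ℂ 2 (μ.prod μ)) (ξ : Lp ℂ 2 μ) :
    kernelOp f ξ =ᵐ[μ] fun x => ∫ y, f (x, y) * ξ y ∂μ :=
  MemLp.coeFn_toLp (memLp_kernelFun f ξ)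

end HilbertSchmidt

section WeakStar

variable (H : Type*) [NormedAddCommGroup H] [InnerProductSpace ℂ H]

/-- The weak* (that is, ultraweak, or `σ`-weak) topology of `B(H)`, given by the duality with the
trace class operators. Trace class operators are the sums `∑ₙ ⟪yₙ, ·⟫ xₙ` with `∑ ‖xₙ‖² < ∞` and
`∑ ‖yₙ‖² < ∞`, and the pairing of `T` with such an operator is `∑ₙ ⟪yₙ, T xₙ⟫`. -/
@[reducible] def weakStarTopology : TopologicalSpace (H →L[ℂ] H) :=
  ⨅ (x : ℕ → H) (y : ℕ → H) (_ : Summable fun n => ‖x n‖ ^ 2) (_ : Summable fun n => ‖y n‖ ^ 2),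
    TopologicalSpace.induced (fun T : H →L[ℂ] H => ∑' n, ⟪y n, T (x n)⟫_ℂ) inferInstance

variable {H}

/-- Positivity of a linear map on `B(H)` (for the Loewner order). -/
def IsPositiveMap (M : (H →L[ℂ] H) →L[ℂ] (H →L[ℂ] H)) : Prop :=
  ∀ T : H →L[ℂ] H, 0 ≤ T → 0 ≤ M T

/-- Complete positivity: all the entrywise amplifications `Mₖ(B(H)) → Mₖ(B(H))` are positive. -/
def IsCompletelyPositiveMap [CompleteSpace H] (M : (H →L[ℂ] H) →L[ℂ] (H →L[ℂ] H)) : Prop :=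
  ∃ Φ : CompletelyPositiveMap (H →L[ℂ] H) (H →L[ℂ] H), Φ.toLinearMap = M.toLinearMap

end WeakStar

variable {X : Type*} [MeasurableSpace X] {μ : Measure X} [SFinite μ]

/-- `φ ∈ L^∞(X × X)` induces a measurable Schur multiplier: the map `K_f ↦ K_{φf}` on the
Hilbert–Schmidt operators is bounded for the operator norm of `B(L²(X))`. -/
def InducesSchurMultiplier (φ : Lp ℂ ∞ (μ.prod μ)) : Prop :=
  ∃ C : ℝ, ∀ f : Lp ℂ 2 (μ.prod μ),
    ‖kernelOp (φ • f : Lp ℂ 2 (μ.prod μ))‖ ≤ C * ‖kernelOp f‖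

/-- `M` is the measurable Schur multiplier `M_φ` with symbol `φ`: the map `K_f ↦ K_{φf}` is
bounded, and `M` is its weak* continuous linear extension to `B(L²(X))`. -/
structure IsSchurMultiplier (φ : Lp ℂ ∞ (μ.prod μ))
    (M : (Lp ℂ 2 μ →L[ℂ] Lp ℂ 2 μ) →L[ℂ] (Lp ℂ 2 μ →L[ℂ] Lp ℂ 2 μ)) : Prop where
  induces : InducesSchurMultiplier φ
  extends_kernel : ∀ f : Lp ℂ 2 (μ.prod μ),
    M (kernelOp f) = kernelOp (φ • f : Lp ℂ 2 (μ.prod μ))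
  weakStar_continuous :
    @Continuous _ _ (weakStarTopology (Lp ℂ 2 μ)) (weakStarTopology (Lp ℂ 2 μ)) M

/-- `φ` induces a positive measurable Schur multiplier. -/
def InducesPositive (φ : Lp ℂ ∞ (μ.prod μ)) : Prop :=
  ∃ M, IsSchurMultiplier φ M ∧ IsPositiveMap M

/-- `φ` induces a completely positive measurable Schur multiplier. -/
def InducesCompletelyPositive (φ : Lp ℂ ∞ (μ.prod μ)) : Prop :=
  ∃ M, IsSchurMultiplier φ M ∧ IsCompletelyPositiveMap M

/-- Integrally positive definite kernels. The order on `ℂ` is the usual partial one, so the last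
condition says that the integral is a nonnegative real number. -/
def IsIntegrallyPositiveDefinite (μ : Measure X) (φ : X × X → ℂ) : Prop :=
  Measurable φ ∧ ∀ ξ : Lp ℂ 1 μ,
    Integrable (fun p : X × X => φ p * starRingEnd ℂ (ξ p.1) * ξ p.2) (μ.prod μ) ∧
    0 ≤ ∫ p : X × X, φ p * starRingEnd ℂ (ξ p.1) * ξ p.2 ∂(μ.prod μ)

end SchurMult

end

/-! Complete positivity trivially gives positivity. For the converse, multiplying `K_f` on both
sides by functions in `L^∞(X)` only multiplies its kernel, so `M_φ` commutes with such
multiplications on rank one operators, hence everywhere by weak* continuity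
(`map_mul_mul_of_rankOne`). As `μ` is finite, the constant `1` is cyclic for `L^∞(X)`, so an
amplification need only be tested on vectors `ξᵢ = aᵢ · 1`. There `∑ ⟪ξᵢ, M(Tᵢⱼ) ξⱼ⟫ = ⟪1, M(∑ aᵢ*
Tᵢⱼ aⱼ) 1⟫`, which is nonnegative by plain positivity (`IsPositiveMap.isCompletelyPositiveMap`). For
integral positive definiteness, `M_φ` sends the positive rank one operator with kernel `1` to the
operator with kernel `φ`. This settles `ξ ∈ L²`, and truncation extends it to `L¹`. -/

noncomputable section

namespace SchurMult

/-! ### Weak* continuity, positivity and operator matrices on a Hilbert space. -/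

section Operators

open Filter Topology InnerProductSpace

variable {H : Type*} [NormedAddCommGroup H] [InnerProductSpace ℂ H]

/-- A bounded family of operators that converges strongly converges in the weak* topology. -/
theorem tendsto_weakStar_of_strong {ι : Type*} {l : Filter ι} {S : ι → H →L[ℂ] H}
    {T : H →L[ℂ] H} {C : ℝ} (hC : ∀ i, ‖S i‖ ≤ C) (hS : ∀ x, Tendsto (fun i => S i x) l (𝓝 (T x))) :
    Tendsto S l (@nhds _ (weakStarTopology H) T) := by
  unfold weakStarTopology
  simp only [nhds_iInf, nhds_induced, tendsto_iInf, tendsto_comap_iff]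
  intro x y hx hy
  refine tendsto_tsum_of_dominated_convergence (bound := fun n => C * (‖x n‖ ^ 2 + ‖y n‖ ^ 2))
    ((hx.add hy).mul_left C) (fun n => tendsto_const_nhds.inner (hS (x n))) ?_
  refine Eventually.of_forall fun i n => ?_
  have hC0 : 0 ≤ C := (norm_nonneg _).trans (hC i)
  calc ‖⟪y n, S i (x n)⟫_ℂ‖ ≤ ‖y n‖ * ‖S i (x n)‖ := norm_inner_le_norm _ _
    _ ≤ ‖y n‖ * (C * ‖x n‖) := by gcongr; exact (S i).le_of_opNorm_le (hC i) _
    _ = C * (‖y n‖ * ‖x n‖) := by ring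
    _ ≤ C * (‖x n‖ ^ 2 + ‖y n‖ ^ 2) := by
      gcongr
      nlinarith [sq_nonneg (‖x n‖ - ‖y n‖), sq_nonneg (‖x n‖), sq_nonneg (‖y n‖)]

/-- Matrix coefficients are continuous for the weak* topology. -/
theorem continuous_weakStar_inner (x y : H) :
    @Continuous _ _ (weakStarTopology H) _ (fun T : H →L[ℂ] H => ⟪y, T x⟫_ℂ) := by
  -- A matrix coefficient is the trace class pairing for sequences supported at index `0`.
  have hs : ∀ z : H, Summable fun n => ‖(Pi.single 0 z : ℕ → H) n‖ ^ 2 := fun z =>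
    summable_of_ne_finset_zero (s := {0}) fun n hn => by
      simp [Pi.single_eq_of_ne (Finset.notMem_singleton.1 hn)]
  have h : (fun T : H →L[ℂ] H => ⟪y, T x⟫_ℂ) = fun T : H →L[ℂ] H =>
      ∑' n, ⟪(Pi.single 0 y : ℕ → H) n, T ((Pi.single 0 x : ℕ → H) n)⟫_ℂ := by
    funext T
    rw [tsum_eq_single 0 fun n hn => by simp [Pi.single_eq_of_ne hn]]
    simp
  rw [h]
  unfold weakStarTopology
  refine continuous_iInf_dom (i := Pi.single 0 x) <| continuous_iInf_dom (i := Pi.single 0 y) <|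
    continuous_iInf_dom (i := hs x) <| continuous_iInf_dom (i := hs y) continuous_induced_dom

/-- The orthogonal projection on the span of a finite set of vectors. -/
def finsetProj (F : Finset H) : H →L[ℂ] H := (Submodule.span ℂ (F : Set H)).starProjection

theorem norm_finsetProj_le (F : Finset H) : ‖finsetProj F‖ ≤ 1 :=
  Submodule.starProjection_norm_le _

theorem tendsto_finsetProj (x : H) : Tendsto (fun F : Finset H => finsetProj F x) atTop (𝓝 x) := by
  refine tendsto_const_nhds.congr' ?_
  filter_upwards [eventually_ge_atTop {x}] with F hF
  exact (Submodule.starProjection_eq_self_iff.2 (Submodule.subset_span (by simpa using hF))).symm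

/-- These finite rank truncations tend to `T` strongly with norm at most `‖T‖`, so identities
between weak* continuous maps pass from rank one operators to all of `B(H)`. -/
theorem comp_finsetProj_mem_span (T : H →L[ℂ] H) (F : Finset H) :
    T ∘L finsetProj F ∈ Submodule.span ℂ {R | ∃ u v : H, R = rankOne ℂ u v} := by
  let b := stdOrthonormalBasis ℂ (Submodule.span ℂ (F : Set H))
  have h : T ∘L finsetProj F = ∑ i, rankOne ℂ (T (b i)) (b i : H) := by
    ext x
    simp [finsetProj, b.starProjection_eq_sum_rankOne]
  rw [h]
  exact Submodule.sum_mem _ fun i _ => Submodule.subset_span ⟨_, _, rfl⟩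

variable [CompleteSpace H]

/-- A weak* continuous map that commutes with a two-sided multiplication `T ↦ A T B` on rank one
operators does so everywhere. -/
theorem map_mul_mul_of_rankOne {M : (H →L[ℂ] H) →L[ℂ] (H →L[ℂ] H)}
    (hM : @Continuous _ _ (weakStarTopology H) (weakStarTopology H) M) (A B : H →L[ℂ] H)
    (h : ∀ u v : H, M (A * rankOne ℂ u v * B) = A * M (rankOne ℂ u v) * B) (T : H →L[ℂ] H) :
    M (A * T * B) = A * M T * B := by
  have hspan : ∀ R ∈ Submodule.span ℂ {R | ∃ u v : H, R = rankOne ℂ u v},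
      M (A * R * B) = A * M R * B := by
    intro R hR
    induction hR using Submodule.span_induction with
    | mem R hR => obtain ⟨u, v, rfl⟩ := hR; exact h u v
    | zero => simp
    | add R S _ _ hR hS => simp only [mul_add, add_mul, map_add, hR, hS]
    | smul c R _ hR => simp only [mul_smul_comm, smul_mul_assoc, map_smul, hR]
  have hw : ∀ (C D : H →L[ℂ] H), Tendsto (fun F : Finset H => C * (T ∘L finsetProj F) * D) atTop
      (@nhds _ (weakStarTopology H) (C * T * D)) := by
    intro C D
    refine tendsto_weakStar_of_strong (C := ‖C‖ * (‖T‖ * 1) * ‖D‖) (fun F => ?_) fun x => ?_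
    · refine (norm_mul_le _ _).trans ?_
      gcongr
      refine (norm_mul_le _ _).trans ?_
      gcongr
      refine (ContinuousLinearMap.opNorm_comp_le _ _).trans ?_
      gcongr
      exact norm_finsetProj_le F
    · exact ((C ∘L T).continuous.tendsto _).comp (tendsto_finsetProj (D x))
  have hT := hw 1 1
  simp only [one_mul, mul_one] at hT
  ext x
  refine ext_inner_left ℂ fun y => ?_
  have hlim : ∀ (x y : H) {S : Finset H → H →L[ℂ] H} {R : H →L[ℂ] H},
      Tendsto S atTop (@nhds _ (weakStarTopology H) R) →
      Tendsto (fun F => ⟪y, M (S F) x⟫_ℂ) atTop (𝓝 ⟪y, M R x⟫_ℂ) := fun x y S R hS =>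
    (@Continuous.tendsto _ _ (weakStarTopology H) _ _
      (@Continuous.comp _ _ _ (weakStarTopology H) (weakStarTopology H) _ _ _
        (continuous_weakStar_inner x y) hM) R).comp hS
  have h1 := hlim x y (hw A B)
  -- Moving `A` and `B` onto the vectors turns the right-hand side into a matrix coefficient of `M
  -- T`.
  have h2 := hlim (B x) (ContinuousLinearMap.adjoint A y) hT
  simp only [ContinuousLinearMap.adjoint_inner_left] at h2
  refine tendsto_nhds_unique h1 (h2.congr fun F => ?_)
  rw [hspan _ (comp_finsetProj_mem_span T F)]
  rfl

theorem IsPositiveMap.map_star {M : (H →L[ℂ] H) →L[ℂ] (H →L[ℂ] H)} (hM : IsPositiveMap M)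
    (T : H →L[ℂ] H) : M (star T) = star (M T) := by
  have hsa : ∀ T : H →L[ℂ] H, IsSelfAdjoint T → IsSelfAdjoint (M T) := by
    intro T hT
    -- A self-adjoint `T` is the difference of the positive operators `‖T‖` and `‖T‖ - T`.
    have h1 : 0 ≤ algebraMap ℝ (H →L[ℂ] H) ‖T‖ - T := sub_nonneg.2 hT.le_algebraMap_norm_self
    have h2 : 0 ≤ algebraMap ℝ (H →L[ℂ] H) ‖T‖ := algebraMap_nonneg _ (norm_nonneg _)
    have h := (hM _ h2).isSelfAdjoint.sub (hM _ h1).isSelfAdjoint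
    rwa [← map_sub, sub_sub_cancel] at h
  have hr := hsa _ (realPart T).2
  have hi := hsa _ (imaginaryPart T).2
  conv_lhs => rw [← realPart_add_I_smul_imaginaryPart T]
  conv_rhs => rw [← realPart_add_I_smul_imaginaryPart T]
  simp only [star_add, star_smul, map_add, map_smul, hr.star_eq, hi.star_eq,
    (realPart T).2.star_eq, (imaginaryPart T).2.star_eq]

/-- Links the C⋆-algebraic compression to the quadratic form of `S`, taken at the `i`-th column of
`N` applied to `x`. -/
theorem inner_cstarMatrix_conj {n : Type*} [Fintype n] (S N : CStarMatrix n n (H →L[ℂ] H))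
    (i : n) (x : H) :
    ⟪x, (star N * S * N) i i x⟫_ℂ = ∑ p, ∑ q, ⟪N p i x, S p q (N q i x)⟫_ℂ := by
  rw [mul_assoc]
  simp only [CStarMatrix.mul_apply, CStarMatrix.star_apply, sum_apply,
    mul_apply_eq_comp, map_sum, inner_sum, ContinuousLinearMap.star_eq_adjoint,
    ContinuousLinearMap.adjoint_inner_right]

/-- A self-adjoint element `S` of a C⋆-algebra is nonnegative if a suitable compression
`-star N * S * N`, which is always of the form `star B * B`, vanishes. -/
theorem exists_conj_eq_neg_star_mul_self {A : Type*} [NonUnitalCStarAlgebra A] [PartialOrder A]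
    [StarOrderedRing A] {S : A} (hS : IsSelfAdjoint S) :
    ∃ N B : A, star N * S * N = -(star B * B) ∧ (B = 0 → 0 ≤ S) := by
  obtain ⟨R, hR⟩ := CStarAlgebra.nonneg_iff_eq_star_mul_self.1 (CFC.negPart_nonneg S)
  have hsa : star S⁻ = S⁻ := (CFC.negPart_nonneg S).isSelfAdjoint
  -- With `S⁻ = R* R`, the compression by `S⁻` is `-(S⁻)³ = -(R S⁻)* (R S⁻)`. If `R S⁻ = 0`, then
  -- `(S⁻)² = R* R S⁻ = 0`, so `S⁻ = 0`.
  refine ⟨S⁻, R * S⁻, ?_, fun hB => ?_⟩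
  · have h1 : S * S⁻ = -(S⁻ * S⁻) := by
      conv_lhs => enter [1]; rw [← CFC.posPart_sub_negPart S]
      rw [sub_mul, CFC.posPart_mul_negPart, zero_sub]
    rw [mul_assoc, h1, mul_neg, star_mul, mul_assoc (star S⁻) (star R), ← mul_assoc (star R), ← hR]
  · rw [CStarAlgebra.nonneg_iff_isSelfAdjoint_and_negPart_eq_zero]
    refine ⟨hS, (CStarRing.star_mul_self_eq_zero_iff S⁻).1 ?_⟩
    rw [hsa]
    nth_rewrite 1 [hR]
    rw [mul_assoc, hB, mul_zero]

/-- A self-adjoint operator matrix whose quadratic form is nonnegative is nonnegative. -/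
theorem cstarMatrix_nonneg {n : Type*} [Fintype n] {S : CStarMatrix n n (H →L[ℂ] H)}
    (hS : IsSelfAdjoint S) (h : ∀ ξ : n → H, 0 ≤ ∑ i, ∑ j, ⟪ξ i, S i j (ξ j)⟫_ℂ) : 0 ≤ S := by
  obtain ⟨N, B, hNB, hB⟩ := exists_conj_eq_neg_star_mul_self hS
  refine hB ?_
  ext p i x
  -- This coefficient is nonnegative by hypothesis, yet equals `-∑ ‖B p i x‖²`, so every entry of
  -- `B` vanishes.
  have h3 : 0 ≤ ⟪x, (star N * S * N) i i x⟫_ℂ := by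
    rw [inner_cstarMatrix_conj]
    exact h fun p => N p i x
  have h4 : ⟪x, (star B * B) i i x⟫_ℂ = ((∑ p, ‖B p i x‖ ^ 2 : ℝ) : ℂ) := by
    rw [CStarMatrix.mul_apply]
    simp [CStarMatrix.star_apply, ContinuousLinearMap.star_eq_adjoint,
      ContinuousLinearMap.adjoint_inner_right]
  rw [hNB, CStarMatrix.neg_apply, neg_apply, inner_neg_right, h4,
    ← Complex.ofReal_neg, Complex.zero_le_real] at h3
  have h5 := (Finset.sum_eq_zero_iff_of_nonneg (fun p _ => sq_nonneg ‖B p i x‖)).1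
    (le_antisymm (neg_nonneg.1 h3) (Finset.sum_nonneg fun p _ => sq_nonneg _)) p
    (Finset.mem_univ p)
  simpa using h5

theorem exists_eq_star_mul_self {A : Type*} [NonUnitalCStarAlgebra A] [PartialOrder A]
    [StarOrderedRing A] {a : A} (ha : 0 ≤ a) : ∃ b, a = star b * b :=
  CStarAlgebra.nonneg_iff_eq_star_mul_self.1 ha

/-- A positive map that is a bimodule map over a family of operators with a cyclic vector is
completely positive. -/
theorem IsPositiveMap.isCompletelyPositiveMap {M : (H →L[ℂ] H) →L[ℂ] (H →L[ℂ] H)}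
    (hM : IsPositiveMap M) {α : Type*} {m : α → H →L[ℂ] H} {e : H}
    (hcyc : DenseRange fun a => m a e)
    (hmod : ∀ a b T, M (star (m a) * T * m b) = star (m a) * M T * m b) :
    IsCompletelyPositiveMap M := by
  refine ⟨⟨M.toLinearMap, fun k T hT => ?_⟩, rfl⟩
  refine cstarMatrix_nonneg ?_ fun ξ => ?_
  · refine CStarMatrix.ext fun i j => ?_
    have hij : star (T j i) = T i j := CStarMatrix.star_apply_of_isSelfAdjoint hT.isSelfAdjoint
    rw [CStarMatrix.star_apply, CStarMatrix.map_apply, CStarMatrix.map_apply, ← hij]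
    exact (hM.map_star (T j i)).symm
  have hcont : Continuous fun ξ : Fin k → H => ∑ i, ∑ j, ⟪ξ i, M (T i j) (ξ j)⟫_ℂ := by fun_prop
  -- Cyclicity and continuity reduce the test vectors to `ξᵢ = m(aᵢ) e`.
  have hdense : DenseRange fun (a : Fin k → α) i => m (a i) e := DenseRange.piMap fun _ => hcyc
  refine hdense.induction_on (p := fun ξ => 0 ≤ ∑ i, ∑ j, ⟪ξ i, M (T i j) (ξ j)⟫_ℂ) ξ
    (isClosed_le continuous_const hcont) fun a => ?_
  obtain ⟨N, hN⟩ := exists_eq_star_mul_self hT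
  -- Writing `T = N* N` exhibits this single operator as a sum of squares, so positivity of `M`
  -- itself suffices.
  have hpos : 0 ≤ ∑ i, ∑ j, star (m (a i)) * T i j * m (a j) := by
    have : ∑ i, ∑ j, star (m (a i)) * T i j * m (a j) =
        ∑ p, star (∑ i, N p i * m (a i)) * ∑ i, N p i * m (a i) := by
      simp only [hN, CStarMatrix.mul_apply, CStarMatrix.star_apply, star_sum, star_mul,
        Finset.mul_sum, Finset.sum_mul]
      rw [Finset.sum_comm]
      conv_rhs => rw [Finset.sum_comm]
      refine Finset.sum_congr rfl fun j _ => ?_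
      rw [Finset.sum_comm]
      simp only [mul_assoc]
    rw [this]
    exact Finset.sum_nonneg fun p _ => star_mul_self_nonneg _
  have h := ((ContinuousLinearMap.nonneg_iff_isPositive _).1 (hM _ hpos)).inner_nonneg_right e
  simp only [map_sum, hmod] at h
  simpa only [sum_apply, mul_apply_eq_comp, inner_sum, ContinuousLinearMap.star_eq_adjoint,
    ContinuousLinearMap.adjoint_inner_right] using h

end Operators

/-! ### Multiplication operators and Hilbert–Schmidt kernels. -/

section Kernels

open Filter Topology InnerProductSpace

variable {X : Type*} [MeasurableSpace X] {μ : Measure X}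

/-- The multiplication operator on `L²(X)` by `a ∈ L^∞(X)`. -/
def mulOp (a : Lp ℂ ∞ μ) : Lp ℂ 2 μ →L[ℂ] Lp ℂ 2 μ :=
  (ContinuousLinearMap.mul ℂ ℂ).holderL μ ∞ 2 2 a

theorem mulOp_apply_ae (a : Lp ℂ ∞ μ) (ξ : Lp ℂ 2 μ) : mulOp a ξ =ᵐ[μ] fun x => a x * ξ x :=
  (ContinuousLinearMap.mul ℂ ℂ).coeFn_holder a ξ

theorem star_mulOp (a : Lp ℂ ∞ μ) : star (mulOp a) = mulOp (star a) := by
  rw [ContinuousLinearMap.star_eq_adjoint, eq_comm, ContinuousLinearMap.eq_adjoint_iff]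
  intro ξ η
  rw [L2.inner_def, L2.inner_def]
  refine integral_congr_ae ?_
  filter_upwards [mulOp_apply_ae a η, mulOp_apply_ae (star a) ξ, Lp.coeFn_star a] with x h1 h2 h3
  simp only [h1, h2, h3, RCLike.inner_apply, Pi.star_apply, map_mul, RCLike.star_def,
    RingHomCompTriple.comp_apply, RingHom.id_apply]
  ring

/-- The orbit of the constant `1` contains every simple function, and these are dense in `L²`. -/
theorem denseRange_mulOp_const [IsFiniteMeasure μ] :
    DenseRange fun a : Lp ℂ ∞ μ => mulOp a (Lp.const 2 μ 1) := by
  refine (Lp.simpleFunc.dense (E := ℂ) (p := 2) (μ := μ) (by norm_num)).mono ?_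
  intro ξ hξ
  let s := Lp.simpleFunc.toSimpleFunc ⟨ξ, hξ⟩
  have hs : s =ᵐ[μ] ξ := Lp.simpleFunc.toSimpleFunc_eq_toFun ⟨ξ, hξ⟩
  refine ⟨(s.memLp_top μ).toLp s, Lp.ext ?_⟩
  filter_upwards [mulOp_apply_ae ((s.memLp_top μ).toLp s) (Lp.const 2 μ 1),
    (s.memLp_top μ).coeFn_toLp, hs, Lp.coeFn_const (p := 2) (μ := μ) (1 : ℂ)] with x h1 h2 h3 h4
  rw [h1, h2, h3, h4, Function.const_apply, mul_one]

theorem lpSMul_comm {Y : Type*} [MeasurableSpace Y] {ν : Measure Y} (φ c : Lp ℂ ∞ ν)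
    (f : Lp ℂ 2 ν) :
    (φ • (c • f : Lp ℂ 2 ν) : Lp ℂ 2 ν) =
      c • (φ • f : Lp ℂ 2 ν) := by
  refine Lp.ext ?_
  filter_upwards [Lp.coeFn_lpSMul (r := 2) c f, Lp.coeFn_lpSMul (r := 2) φ f,
    Lp.coeFn_lpSMul (r := 2) φ (c • f : Lp ℂ 2 ν),
    Lp.coeFn_lpSMul (r := 2) c (φ • f : Lp ℂ 2 ν)] with p h1 h2 h3 h4
  simp only [h1, h2, h3, h4, Pi.smul_apply', smul_eq_mul]
  ring

theorem memLp_tensor (u v : Lp ℂ 2 μ) :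
    MemLp (fun p : X × X => u p.1 * starRingEnd ℂ (v p.2)) 2 (μ.prod μ) := by
  have hm : AEStronglyMeasurable (fun p : X × X => u p.1 * starRingEnd ℂ (v p.2)) (μ.prod μ) :=
    (Lp.aestronglyMeasurable u).comp_fst.mul
      (RCLike.continuous_conj.comp_aestronglyMeasurable (Lp.aestronglyMeasurable v).comp_snd)
  rw [memLp_two_iff_integrable_sq_norm hm]
  simpa [mul_pow] using (Lp.memLp u).norm.integrable_sq.mul_prod (Lp.memLp v).norm.integrable_sq

theorem integrable_symbol_mul (φ : Lp ℂ ∞ (μ.prod μ)) (ξ : Lp ℂ 1 μ) :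
    Integrable (fun p : X × X => φ p * starRingEnd ℂ (ξ p.1) * ξ p.2) (μ.prod μ) := by
  have hξ : Integrable ξ μ := memLp_one_iff_integrable.1 (Lp.memLp ξ)
  have hξ' : Integrable (fun x => starRingEnd ℂ (ξ x)) μ :=
    memLp_one_iff_integrable.1 (Lp.memLp ξ).star
  have h := MemLp.mul (r := 1) (memLp_one_iff_integrable.2 (hξ'.mul_prod hξ)) (Lp.memLp φ)
  simpa only [Pi.mul_def, mul_assoc] using memLp_one_iff_integrable.1 h

variable [SFinite μ]

/-- Every rank one operator is a Hilbert–Schmidt operator. -/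
theorem kernelOp_tensor (u v : Lp ℂ 2 μ) :
    kernelOp ((memLp_tensor u v).toLp _) = rankOne ℂ u v := by
  refine ContinuousLinearMap.ext fun ξ => Lp.ext ?_
  rw [rankOne_apply]
  filter_upwards [kernelOp_apply_ae ((memLp_tensor u v).toLp _) ξ,
    Measure.ae_ae_of_ae_prod (memLp_tensor u v).coeFn_toLp,
    Lp.coeFn_smul (⟪v, ξ⟫_ℂ) u] with x h1 h2 h3
  rw [h1, h3, Pi.smul_apply, smul_eq_mul, L2.inner_def, mul_comm, ← integral_const_mul]
  refine integral_congr_ae ?_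
  filter_upwards [h2] with y hy
  rw [hy, RCLike.inner_apply]
  ring

theorem memLp_top_tensor [IsFiniteMeasure μ] (a b : Lp ℂ ∞ μ) :
    MemLp (fun p : X × X => a p.1 * b p.2) ∞ (μ.prod μ) :=
  ((Lp.memLp b).comp_snd μ).mul ((Lp.memLp a).comp_fst μ)

/-- Compressing a Hilbert–Schmidt operator by multiplication operators multiplies its kernel. -/
theorem mulOp_mul_kernelOp_mul_mulOp [IsFiniteMeasure μ] (a b : Lp ℂ ∞ μ) (f : Lp ℂ 2 (μ.prod μ)) :
    mulOp a * kernelOp f * mulOp b =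
      kernelOp ((memLp_top_tensor a b).toLp _ • f : Lp ℂ 2 (μ.prod μ)) := by
  refine ContinuousLinearMap.ext fun ξ => Lp.ext ?_
  set c := (memLp_top_tensor a b).toLp _
  have hc : (c • f : Lp ℂ 2 (μ.prod μ)) =ᵐ[μ.prod μ] fun p => a p.1 * b p.2 * f p := by
    filter_upwards [Lp.coeFn_lpSMul (r := 2) c f, (memLp_top_tensor a b).coeFn_toLp] with p h1 h2
    rw [h1, Pi.smul_apply', smul_eq_mul, h2]
  filter_upwards [kernelOp_apply_ae (c • f : Lp ℂ 2 (μ.prod μ)) ξ,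
    mulOp_apply_ae a (kernelOp f (mulOp b ξ)), kernelOp_apply_ae f (mulOp b ξ),
    Measure.ae_ae_of_ae_prod hc] with x h1 h2 h3 h4
  refine (h2.trans ?_).trans h1.symm
  rw [h3, ← integral_const_mul]
  refine integral_congr_ae ?_
  filter_upwards [h4, mulOp_apply_ae b ξ] with y h5 h6
  rw [h5, h6]
  ring

/-- Fubini turns positivity of a Hilbert–Schmidt operator into the double integral condition on its
kernel. -/
theorem inner_kernelOp (f : Lp ℂ 2 (μ.prod μ)) (ξ η : Lp ℂ 2 μ) :
    ⟪ξ, kernelOp f η⟫_ℂ =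
      ∫ p : X × X, f p * starRingEnd ℂ (ξ p.1) * η p.2 ∂(μ.prod μ) := by
  have hint : Integrable (fun p : X × X => f p * starRingEnd ℂ (ξ p.1) * η p.2) (μ.prod μ) := by
    refine ((Lp.memLp f).integrable_mul (memLp_tensor ξ η).star).congr
      (Eventually.of_forall fun p => ?_)
    simp [mul_assoc]
  rw [L2.inner_def, integral_prod _ hint]
  refine integral_congr_ae ?_
  filter_upwards [kernelOp_apply_ae f η] with x hx
  rw [hx, RCLike.inner_apply, mul_comm, ← integral_const_mul]
  refine integral_congr_ae (Eventually.of_forall fun y => ?_)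
  ring

end Kernels

/-! ### Schur multipliers: the bimodule property and the implications. -/

section Multipliers

open Filter Topology InnerProductSpace

variable {X : Type*} [MeasurableSpace X] {μ : Measure X} [IsFiniteMeasure μ]
  {φ : Lp ℂ ∞ (μ.prod μ)}

/-- A measurable Schur multiplier is a bimodule map over `L^∞(X)`. -/
theorem IsSchurMultiplier.map_mulOp_mul_mulOp
    {M : (Lp ℂ 2 μ →L[ℂ] Lp ℂ 2 μ) →L[ℂ] (Lp ℂ 2 μ →L[ℂ] Lp ℂ 2 μ)}
    (hM : IsSchurMultiplier φ M) (a b : Lp ℂ ∞ μ) (T : Lp ℂ 2 μ →L[ℂ] Lp ℂ 2 μ) :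
    M (mulOp a * T * mulOp b) = mulOp a * M T * mulOp b := by
  refine map_mul_mul_of_rankOne hM.weakStar_continuous _ _ (fun u v => ?_) T
  -- On kernels, both operations are pointwise multiplications, by `φ(x,y)` and by `a(x) b(y)`, so
  -- they commute.
  rw [← kernelOp_tensor, mulOp_mul_kernelOp_mul_mulOp, hM.extends_kernel, hM.extends_kernel,
    mulOp_mul_kernelOp_mul_mulOp, lpSMul_comm]

theorem InducesCompletelyPositive.inducesPositive (h : InducesCompletelyPositive φ) :
    InducesPositive φ := by
  obtain ⟨M, hM, Φ, hΦ⟩ := h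
  refine ⟨M, hM, fun T hT => ?_⟩
  have h : Φ T = M T := LinearMap.congr_fun hΦ T
  rw [← h]
  exact map_nonneg Φ hT

theorem InducesPositive.inducesCompletelyPositive (h : InducesPositive φ) :
    InducesCompletelyPositive φ := by
  obtain ⟨M, hM, hpos⟩ := h
  refine ⟨M, hM, hpos.isCompletelyPositiveMap denseRange_mulOp_const fun a b T => ?_⟩
  rw [star_mulOp, hM.map_mulOp_mul_mulOp]

theorem InducesPositive.integral_nonneg (h : InducesPositive φ) (ξ : Lp ℂ 2 μ) :
    0 ≤ ∫ p : X × X, φ p * starRingEnd ℂ (ξ p.1) * ξ p.2 ∂(μ.prod μ) := by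
  obtain ⟨M, hM, hpos⟩ := h
  -- The kernel of `e ⊗ e` is the constant `1`, so `M` sends this positive rank one operator to the
  -- one with kernel `φ`.
  set e : Lp ℂ 2 μ := Lp.const 2 μ 1
  have he : ∀ᵐ x ∂μ, e x = 1 := Lp.coeFn_const (p := 2) (μ := μ) (1 : ℂ)
  set f := (memLp_tensor e e).toLp _
  have hK : 0 ≤ kernelOp f := by
    rw [kernelOp_tensor, ContinuousLinearMap.nonneg_iff_isPositive]
    exact isPositive_rankOne_self e
  have h := ((ContinuousLinearMap.nonneg_iff_isPositive _).1 (hpos _ hK)).inner_nonneg_right ξ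
  rw [hM.extends_kernel, inner_kernelOp] at h
  refine h.trans_eq (integral_congr_ae ?_)
  filter_upwards [Lp.coeFn_lpSMul (r := 2) φ f, (memLp_tensor e e).coeFn_toLp,
    Measure.quasiMeasurePreserving_fst.ae he, Measure.quasiMeasurePreserving_snd.ae he]
    with p h1 h2 h3 h4
  rw [h1, Pi.smul_apply', h2, h3, h4]
  simp

/-- Cutting `ξ` off where `‖ξ‖ > n` gives bounded functions, which lie in `L²` since `μ` is finite.
Dominated convergence, with the integrand for `ξ` as bound, then carries the inequality to the
limit. -/
theorem InducesPositive.integral_nonneg_of_L1 (h : InducesPositive φ) (ξ : Lp ℂ 1 μ) :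
    0 ≤ ∫ p : X × X, φ p * starRingEnd ℂ (ξ p.1) * ξ p.2 ∂(μ.prod μ) := by
  let s : ℕ → Set X := fun n => {x | ‖ξ x‖ ≤ n}
  let g : ℕ → X → ℂ := fun n => (s n).indicator ξ
  have hs : ∀ n, MeasurableSet (s n) := fun n =>
    measurableSet_le (Lp.stronglyMeasurable ξ).measurable.norm measurable_const
  have hgm : ∀ n, StronglyMeasurable (g n) := fun n => (Lp.stronglyMeasurable ξ).indicator (hs n)
  have hg2 : ∀ n, MemLp (g n) 2 μ := fun n => by
    refine MemLp.of_bound (hgm n).aestronglyMeasurable n (Eventually.of_forall fun x => ?_)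
    by_cases hx : x ∈ s n
    · exact (congrArg norm (Set.indicator_of_mem hx ξ)).trans_le hx
    · simp [g, hx]
  have hle : ∀ n x, ‖g n x‖ ≤ ‖ξ x‖ := fun n x => norm_indicator_le_norm_self _ _
  have hlim : ∀ x, Tendsto (fun n => g n x) atTop (𝓝 (ξ x)) := fun x => by
    obtain ⟨N, hN⟩ := exists_nat_ge ‖ξ x‖
    refine tendsto_const_nhds.congr' ?_
    filter_upwards [eventually_ge_atTop N] with n hn
    have hx : x ∈ s n := hN.trans (Nat.cast_le.2 hn)
    exact (Set.indicator_of_mem hx ξ).symm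
  have hpos : ∀ n, 0 ≤ ∫ p : X × X, φ p * starRingEnd ℂ (g n p.1) * g n p.2 ∂(μ.prod μ) := by
    intro n
    refine (h.integral_nonneg ((hg2 n).toLp (g n))).trans_eq (integral_congr_ae ?_)
    filter_upwards [Measure.quasiMeasurePreserving_fst.ae (hg2 n).coeFn_toLp,
      Measure.quasiMeasurePreserving_snd.ae (hg2 n).coeFn_toLp] with p h1 h2
    rw [h1, h2]
  refine ge_of_tendsto' (tendsto_integral_of_dominated_convergence
    (fun p => ‖φ p * starRingEnd ℂ (ξ p.1) * ξ p.2‖) (fun n => ?_)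
    (integrable_symbol_mul φ ξ).norm (fun n => Eventually.of_forall fun p => ?_)
    (Eventually.of_forall fun p => ?_)) hpos
  · exact ((Lp.aestronglyMeasurable φ).mul (RCLike.continuous_conj.comp_aestronglyMeasurable
      (hgm n).aestronglyMeasurable.comp_fst)).mul (hgm n).aestronglyMeasurable.comp_snd
  · simp only [norm_mul, RCLike.norm_conj]
    gcongr <;> exact hle n _
  · exact (tendsto_const_nhds.mul ((RCLike.continuous_conj.tendsto _).comp (hlim p.1))).mul
      (hlim p.2)

theorem InducesPositive.isIntegrallyPositiveDefinite (h : InducesPositive φ) {ψ : X × X → ℂ}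
    (hψ : Measurable ψ) (hψφ : ψ =ᵐ[μ.prod μ] φ) : IsIntegrallyPositiveDefinite μ ψ := by
  refine ⟨hψ, fun ξ => ?_⟩
  have hae : (fun p : X × X => φ p * starRingEnd ℂ (ξ p.1) * ξ p.2) =ᵐ[μ.prod μ]
      fun p => ψ p * starRingEnd ℂ (ξ p.1) * ξ p.2 := by
    filter_upwards [hψφ] with p hp
    rw [hp]
  exact ⟨(integrable_symbol_mul φ ξ).congr hae,
    (h.integral_nonneg_of_L1 ξ).trans_eq (integral_congr_ae hae)⟩

end Multipliers

end SchurMult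

end

theorem mainTheorem7 {X : Type*} [MeasurableSpace X] (μ : Measure X) [IsFiniteMeasure μ]
    (φ : Lp ℂ ∞ (μ.prod μ)) :
    (SchurMult.InducesCompletelyPositive φ ↔ SchurMult.InducesPositive φ) ∧
    (SchurMult.InducesPositive φ →
      ∀ ψ : X × X → ℂ, Measurable ψ → ψ =ᵐ[μ.prod μ] φ →
        SchurMult.IsIntegrallyPositiveDefinite μ ψ) :=
  ⟨⟨fun h => h.inducesPositive, fun h => h.inducesCompletelyPositive⟩,
    fun h _ hψ hψφ => h.isIntegrallyPositiveDefinite hψ hψφ⟩
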